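/- For a countably infinite set $X$, let $\mathrm{Sym}(X)$ be the group of permutations of $X$ with the topology of pointwise convergence ($X$ discrete); subgroups carry the subspace topology and quotients the quotient topology. A topological group is profinite if it is compact, Hausdorff and totally disconnected. (1) Let $M$ be a countably infinite structure in a countable signature that is $\aleph_0$-categorical, i.e. all countably infinite models of $\mathrm{Th}(M)$ are isomorphic. Let $\mathcal{E}_M$ be the orbital structure of $M$: it has the same domain as $M$ and, for each $n>0$, one $2n$-ary relation $\sim_n$, where for $n$-tuples $\bar a,\bar b$ one has $\bar a\sim_n\bar b$ if and only if $g(\bar a)=\bar b$ for some $g\in\mathrm{Aut}(M)$. Then $\mathrm{Aut}(\mathcal{E}_M)$ is the normaliser of $\mathrm{Aut}(M)$ in $\mathrm{Sym}(M)$, and the quotient $V=\mathrm{Aut}(\mathcal{E}_M)/\mathrm{Aut}(M)$ is a profinite group. If moreover $M$ is interdefinable with a structure in a finite signature (a structure on the same domain such that all relations and functions of each of the two structures are definable without parameters in the other), then $V$ is finite. (2) Equivalently, in terms of permutation groups: if $X$ is a countably infinite set and $G\leq\mathrm{Sym}(X)$ is a closed oligomorphic subgroup (for each $n$, $G$ has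 only finitely many orbits on $X^n$), with normaliser $N_G$ in $\mathrm{Sym}(X)$, then $N_G/G$ is a profinite group. -/

import Mathlib

universe u v u' v' w

namespace OrbitalProfinite

open FirstOrder FirstOrder.Language

/-- The topology of pointwise convergence on `Sym(X)`, where `X` is discrete: a neighbourhood basis
of `1` is given by the pointwise stabilisers of finite sets. -/
instance permTopology (X : Type*) : TopologicalSpace (Equiv.Perm X) :=
  TopologicalSpace.induced (fun g : Equiv.Perm X => (g : X → X))
    (@Pi.topologicalSpace X (fun _ => X) (fun _ => ⊥))

/-- A profinite group: a compact, Hausdorff, totally disconnected topological group. -/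
structure IsProfiniteGroup (V : Type*) [Group V] [TopologicalSpace V] : Prop where
  isTopologicalGroup : IsTopologicalGroup V
  compactSpace : CompactSpace V
  t2Space : T2Space V
  totallyDisconnectedSpace : TotallyDisconnectedSpace V

/-- A permutation group is oligomorphic if for each `n` it has only finitely many orbits on
`n`-tuples. -/
def IsOligomorphic {X : Type*} (G : Subgroup (Equiv.Perm X)) : Prop :=
  ∀ n : ℕ, Finite (MulAction.orbitRel.Quotient G (Fin n → X))

/-- A countably infinite structure is `ℵ₀`-categorical if all countably infinite models of its
complete theory are isomorphic. -/
structure IsAlephZeroCategorical (L : FirstOrder.Language.{u, v}) (M : Type w) [L.Structure M] : Prop where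
  countable : Countable M
  infinite : Infinite M
  categorical : Cardinal.aleph0.{w}.Categorical (L.completeTheory M)

/-- The automorphism group of a structure, as a group of permutations of its domain. -/
def aut (L : FirstOrder.Language) (M : Type*) [L.Structure M] : Subgroup (Equiv.Perm M) where
  carrier := {g | ∃ e : M ≃[L] M, e.toEquiv = g}
  mul_mem' := by
    rintro _ _ ⟨e, rfl⟩ ⟨f, rfl⟩
    exact ⟨e.comp f, rfl⟩
  one_mem' := ⟨FirstOrder.Language.Equiv.refl L M, rfl⟩
  inv_mem' := by
    rintro _ ⟨e, rfl⟩
    exact ⟨e.symm, rfl⟩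

/-- The relation symbols `∼ₙ`, of arity `2n`, for `0 < n`. -/
inductive OrbitalRel : ℕ → Type
  | sim (n : ℕ) (hn : 0 < n) : OrbitalRel (n + n)

/-- The language `{∼ₙ : 0 < n < ω}`. -/
def orbitalLanguage : FirstOrder.Language where
  Functions := fun _ => Empty
  Relations := OrbitalRel

/-- The orbital structure `E_M` of `M`, with the same domain: `a ∼ₙ b` iff some automorphism of `M`
takes the `n`-tuple `a` to the `n`-tuple `b`. -/
@[reducible] def orbitalStructure (L : FirstOrder.Language) (M : Type*) [L.Structure M] :
    orbitalLanguage.Structure M where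
  funMap := fun f _ => nomatch f
  RelMap := fun r x => match r, x with
    | .sim n _, x => ∃ g ∈ aut L M, ∀ i : Fin n, g (x (Fin.castAdd n i)) = x (Fin.natAdd n i)

/-- The automorphism group of the orbital structure of `M`. -/
def autOrbital (L : FirstOrder.Language) (M : Type*) [L.Structure M] : Subgroup (Equiv.Perm M) :=
  @aut orbitalLanguage M (orbitalStructure L M)

section helpers

variable {L : FirstOrder.Language} {M : Type*} [L.Structure M]

theorem sim_iff_of_mem_autOrbital {h : Equiv.Perm M} (hh : h ∈ autOrbital L M) {n : ℕ}
    (hn : 0 < n) (a b : Fin n → M) :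
    (∃ g ∈ aut L M, ∀ i, g (h (a i)) = h (b i)) ↔ ∃ g ∈ aut L M, ∀ i, g (a i) = b i := by
  obtain ⟨e, rfl⟩ := hh
  let := orbitalStructure L M
  have := e.map_rel (OrbitalRel.sim n hn : orbitalLanguage.Relations (n + n)) (Fin.append a b)
  change (∃ g ∈ aut L M, ∀ i : Fin n, g (e (Fin.append a b (Fin.castAdd n i))) =
    e (Fin.append a b (Fin.natAdd n i))) ↔ (∃ g ∈ aut L M, ∀ i : Fin n,
      g (Fin.append a b (Fin.castAdd n i)) = Fin.append a b (Fin.natAdd n i)) at this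
  simp only [Fin.append_left, Fin.append_right] at this
  exact this

theorem mem_autOrbital_of {h : Equiv.Perm M}
    (hh : ∀ n : ℕ, 0 < n → ∀ a b : Fin n → M,
      (∃ g ∈ aut L M, ∀ i, g (h (a i)) = h (b i)) ↔ ∃ g ∈ aut L M, ∀ i, g (a i) = b i) :
    h ∈ autOrbital L M := by
  let := orbitalStructure L M
  refine ⟨{ toEquiv := h, map_fun' := fun {n} f _ => (nomatch f), map_rel' := fun {n} r x => ?_ }, rfl⟩
  cases r with
  | sim n hn => exact hh n hn (fun i => x (Fin.castAdd n i)) (fun i => x (Fin.natAdd n i))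

theorem aut_le_autOrbital : aut L M ≤ autOrbital L M := by
  intro h hh
  refine mem_autOrbital_of fun n _ a b => ⟨?_, ?_⟩
  · rintro ⟨g, hg, H⟩
    refine ⟨h⁻¹ * g * h, mul_mem (mul_mem (inv_mem hh) hg) hh, fun i => ?_⟩
    simp [H i]
  · rintro ⟨g, hg, H⟩
    refine ⟨h * g * h⁻¹, mul_mem (mul_mem hh hg) (inv_mem hh), fun i => ?_⟩
    simp [H i]

/-- If every nonempty tuple can be moved by an automorphism in the same way as by `k`, then `k` is an
automorphism. -/
theorem mem_aut_of_locally {k : Equiv.Perm M}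
    (hk : ∀ n : ℕ, 0 < n → ∀ a : Fin n → M, ∃ g ∈ aut L M, ∀ i, g (a i) = k (a i)) :
    k ∈ aut L M := by
  refine ⟨{ toEquiv := k, map_fun' := fun {n} f x => ?_, map_rel' := fun {n} r x => ?_ }, rfl⟩
  · obtain ⟨_, ⟨e, rfl⟩, H⟩ := hk (n + 1) n.succ_pos (Fin.snoc x (Structure.funMap f x))
    have h1 : e (Structure.funMap f x) = k (Structure.funMap f x) := by
      have h0 := H (Fin.last n)
      rw [Fin.snoc_last] at h0
      exact h0
    have h2 : e ∘ x = k ∘ x := funext fun i => by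
      have h0 := H i.castSucc
      rw [Fin.snoc_castSucc (α := fun _ => M)] at h0
      exact h0
    change k (Structure.funMap f x) = Structure.funMap f (k ∘ x)
    rw [← h1, ← h2]
    exact e.map_fun f x
  · change Structure.RelMap r (k ∘ x) ↔ _
    rcases Nat.eq_zero_or_pos n with rfl | hn
    · rw [Subsingleton.elim (k ∘ x) x]
    · obtain ⟨_, ⟨e, rfl⟩, H⟩ := hk n hn x
      have h2 : e ∘ x = k ∘ x := funext fun i => H i
      rw [← h2]
      exact e.map_rel r x

/-- `Aut(M)` is normal in `Aut(E_M)`, so that the quotient below is a group. -/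
instance normal_aut : ((aut L M).subgroupOf (autOrbital L M)).Normal := by
  refine ⟨fun g hg h => ?_⟩
  rw [Subgroup.mem_subgroupOf] at hg ⊢
  refine mem_aut_of_locally fun n hn a => ?_
  have := (sim_iff_of_mem_autOrbital h.2 hn (fun i => (h : Equiv.Perm M)⁻¹ (a i))
    (fun i => g.1 ((h : Equiv.Perm M)⁻¹ (a i)))).2 ⟨g, hg, fun _ => rfl⟩
  simpa using this

end helpers

/-- `V = Aut(E_M)/Aut(M)`, with the quotient of the topology of pointwise convergence. -/
abbrev OrbitalQuotient (L : FirstOrder.Language) (M : Type*) [L.Structure M] : Type _ :=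
  autOrbital L M ⧸ (aut L M).subgroupOf (autOrbital L M)

/-- The `L'`-structure on `M` is a reduct of the `L`-structure on `M`: each relation and function of
the former is definable without parameters in the latter. -/
def IsReduct (L L' : FirstOrder.Language) (M : Type*) [L.Structure M] [L'.Structure M] : Prop :=
  (∀ (n : ℕ) (f : L'.Functions n),
      (∅ : Set M).DefinableFun L (fun x : Fin n → M => Structure.funMap f x)) ∧
    ∀ (n : ℕ) (r : L'.Relations n), (∅ : Set M).Definable L {x : Fin n → M | Structure.RelMap r x}

/-- Two structures on the same domain are interdefinable if each is a reduct of the other. -/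
def Interdefinable (L L' : FirstOrder.Language) (M : Type*) [L.Structure M] [L'.Structure M] : Prop :=
  IsReduct L L' M ∧ IsReduct L' L M

end OrbitalProfinite

/-!
The proof of the second part: let `G` be a closed oligomorphic group of permutations of a countable
set `X`, and `N` its normaliser. `N` acts on the set of `G`-orbits of `n`-tuples, a finite set `Oₙ`,
for each `n`. The kernel of all these actions together is `G`, because `G` is closed, and `N / G`
carries the topology induced from `∏ₙ (Oₙ → Oₙ)`, a product of finite discrete spaces: if `h` and `k`
act alike on the orbit of a tuple `a`, then `k` agrees with `h` on `a` up to an element of `G`. The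
image is closed (`exists_orbitAction_eq`): a family of maps `Oₙ → Oₙ` that is approximated by elements
of `N` is induced by a permutation built by back and forth (`exists_perm_of_back_and_forth`), and this
permutation normalises the closed group `G`. So `N / G` is a closed subspace of a profinite space.

For the first part, `Aut(E_M)` is the normaliser of `Aut(M)` by unravelling the definitions, and
`Aut(M)` is closed. That it is oligomorphic is the theorem of Ryll-Nardzewski, for which the tuples
of elements of `M` are given the topology generated by the sets definable without parameters.
Compactness, Löwenheim–Skolem and categoricity make the spaces `Mⁿ` and `M^ℕ` compact
(`IsAlephZeroCategorical.compactSpace`). A generic element of `M^ℕ`, in the sense of Baire category,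
enumerates an elementary substructure that omits a given non-isolated type; as this substructure is
isomorphic to `M`, all types realised in `M` are isolated (`IsAlephZeroCategorical.exists_isolating`).
Then back and forth shows that tuples of the same type lie in one orbit, and compactness of `Mⁿ` that
there are finitely many types.

Finally, interdefinable structures have the same automorphisms, and in a finite signature the
automorphisms are recognised on tuples of one length `m`. So `N / G` acts faithfully on the finite set
`Oₘ`.
-/

namespace OrbitalProfinite

open FirstOrder FirstOrder.Language

/-! ### Back and forth -/

/-- A pair of tuples of the same length related by `E`, viewed as a finite condition on a
permutation: the first tuple is to be sent to the second. -/
structure Condition {X : Type*} (E : ∀ n : ℕ, (Fin n → X) → (Fin n → X) → Prop) where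
  /-- The length of the tuples. -/
  n : ℕ
  /-- The tuple of arguments. -/
  a : Fin n → X
  /-- The tuple of values. -/
  b : Fin n → X
  rel : E n a b

/-- A condition is stronger if the weaker one is obtained from it by reindexing. -/
instance {X : Type*} (E : ∀ n : ℕ, (Fin n → X) → (Fin n → X) → Prop) : Preorder (Condition E) where
  le p q := ∃ f : Fin p.n → Fin q.n, q.a ∘ f = p.a ∧ q.b ∘ f = p.b
  le_refl p := ⟨id, rfl, rfl⟩
  le_trans := by
    rintro p q r ⟨f, h1, h2⟩ ⟨f', h3, h4⟩
    refine ⟨f' ∘ f, ?_, ?_⟩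
    · rw [← Function.comp_assoc, h3, h1]
    · rw [← Function.comp_assoc, h4, h2]

/-- Back and forth: on a countable set, if a relation `E` between tuples is stable under reindexing,
respects equality of entries and allows extension by one entry on either side, then related tuples
are matched by a permutation, all of whose finite restrictions are in `E`. -/
theorem exists_perm_of_back_and_forth {X : Type*} [Countable X]
    (E : ∀ n : ℕ, (Fin n → X) → (Fin n → X) → Prop)
    (reindex : ∀ {m k : ℕ} {a b : Fin m → X} (f : Fin k → Fin m), E m a b → E k (a ∘ f) (b ∘ f))
    (eq_iff : ∀ {n : ℕ} {a b : Fin n → X}, E n a b → ∀ i j, a i = a j ↔ b i = b j)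
    (forth : ∀ {n : ℕ} {a b : Fin n → X}, E n a b →
      ∀ x, ∃ y, E (n + 1) (Fin.snoc a x : Fin (n + 1) → X) (Fin.snoc b y : Fin (n + 1) → X))
    (back : ∀ {n : ℕ} {a b : Fin n → X}, E n a b →
      ∀ y, ∃ x, E (n + 1) (Fin.snoc a x : Fin (n + 1) → X) (Fin.snoc b y : Fin (n + 1) → X))
    {n : ℕ} {a b : Fin n → X} (hab : E n a b) :
    ∃ g : Equiv.Perm X, (∀ i, g (a i) = b i) ∧
      ∀ (k : ℕ) (c : Fin k → X), E k c (fun i => g (c i)) := by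
  have := Encodable.ofCountable X
  have hle : ∀ (p : Condition E) (x y : X)
      (h : E (p.n + 1) (Fin.snoc p.a x : Fin (p.n + 1) → X) (Fin.snoc p.b y : Fin (p.n + 1) → X)),
      p ≤ ⟨p.n + 1, Fin.snoc p.a x, Fin.snoc p.b y, h⟩ := fun p x y h =>
    ⟨Fin.castSucc, funext fun i => Fin.snoc_castSucc (α := fun _ => X) _ _ i,
      funext fun i => Fin.snoc_castSucc (α := fun _ => X) _ _ i⟩
  let D : X ⊕ X → Order.Cofinal (Condition E) := Sum.elim
    (fun x => ⟨{p | ∃ i, p.a i = x}, fun p => by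
      obtain ⟨y, hy⟩ := forth p.rel x
      exact ⟨_, ⟨Fin.last _, Fin.snoc_last (α := fun _ => X) _ _⟩, hle p x y hy⟩⟩)
    (fun y => ⟨{p | ∃ i, p.b i = y}, fun p => by
      obtain ⟨x, hx⟩ := back p.rel y
      exact ⟨_, ⟨Fin.last _, Fin.snoc_last (α := fun _ => X) _ _⟩, hle p x y hx⟩⟩)
  let p₀ : Condition E := ⟨n, a, b, hab⟩
  let I := Order.idealOfCofinals p₀ D
  have hI : ∀ p ∈ I, ∀ q ∈ I, ∃ r ∈ I, p ≤ r ∧ q ≤ r := fun p hp q hq => I.directed p hp q hq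
  have hfun : ∀ p ∈ I, ∀ q ∈ I, ∀ i j, p.a i = q.a j ↔ p.b i = q.b j := by
    intro p hp q hq i j
    obtain ⟨r, -, ⟨f, hf, hf'⟩, ⟨f', hg, hg'⟩⟩ := hI p hp q hq
    rw [← hf, ← hf', ← hg, ← hg']
    exact eq_iff r.rel _ _
  have hdom : ∀ x, ∃ y, ∃ p ∈ I, ∃ i, p.a i = x ∧ p.b i = y := fun x => by
    obtain ⟨p, ⟨i, hi⟩, hp⟩ := Order.cofinal_meets_idealOfCofinals p₀ D (Sum.inl x)
    exact ⟨_, p, hp, i, hi, rfl⟩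
  have hran : ∀ y, ∃ x, ∃ p ∈ I, ∃ i, p.a i = x ∧ p.b i = y := fun y => by
    obtain ⟨p, ⟨i, hi⟩, hp⟩ := Order.cofinal_meets_idealOfCofinals p₀ D (Sum.inr y)
    exact ⟨_, p, hp, i, rfl, hi⟩
  choose F hF using hdom
  choose F' hF' using hran
  have hFp : ∀ p ∈ I, ∀ i, F (p.a i) = p.b i := by
    intro p hp i
    obtain ⟨q, hq, j, h1, h2⟩ := hF (p.a i)
    rw [← h2]
    exact (hfun q hq p hp j i).1 h1
  let g : Equiv.Perm X :=
    { toFun := F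
      invFun := F'
      left_inv := fun x => by
        obtain ⟨q, hq, j, h1, h2⟩ := hF' (F x)
        obtain ⟨p, hp, i, h3, h4⟩ := hF x
        rw [← h1, ← h3]
        exact (hfun q hq p hp j i).2 (h2.trans h4.symm)
      right_inv := fun y => by
        obtain ⟨q, hq, j, h1, h2⟩ := hF' y
        rw [← h1, hFp q hq, h2] }
  refine ⟨g, fun i => hFp p₀ (Order.mem_idealOfCofinals p₀ D) i, fun k c => ?_⟩
  have key : ∀ (k : ℕ) (c : Fin k → X), ∃ p ∈ I, ∃ f : Fin k → Fin p.n, p.a ∘ f = c := by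
    intro k
    induction k with
    | zero => exact fun c => ⟨p₀, Order.mem_idealOfCofinals p₀ D, Fin.elim0, Subsingleton.elim _ _⟩
    | succ k ih =>
      intro c
      obtain ⟨p, hp, f, hf⟩ := ih (Fin.init c)
      obtain ⟨q, hq, j, hj, -⟩ := hF (c (Fin.last k))
      obtain ⟨r, hr, ⟨f1, h1, -⟩, ⟨f2, h2, -⟩⟩ := hI p hp q hq
      refine ⟨r, hr, Fin.snoc (f1 ∘ f) (f2 j), funext fun i => ?_⟩
      refine Fin.lastCases ?_ (fun i => ?_) i
      · rw [Function.comp_apply, Fin.snoc_last (α := fun _ => Fin r.n), ← hj, ← h2]; rfl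
      · rw [Function.comp_apply, Fin.snoc_castSucc (α := fun _ => Fin r.n)]
        change (r.a ∘ f1) (f i) = _
        rw [h1]
        exact congrFun hf i
  obtain ⟨p, hp, f, rfl⟩ := key k c
  have : (fun i => g ((p.a ∘ f) i)) = p.b ∘ f := funext fun i => hFp p hp (f i)
  rw [this]
  exact reindex f p.rel

/-! ### The group of permutations with the topology of pointwise convergence -/

section PermTopology

variable {X : Type*}

/-- The permutations that agree with `h` on a given finite tuple form a neighbourhood of `h`, and
these neighbourhoods form a basis. -/
theorem mem_nhds_perm_iff {h : Equiv.Perm X} {W : Set (Equiv.Perm X)} :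
    W ∈ nhds h ↔ ∃ (n : ℕ) (a : Fin n → X), ∀ k : Equiv.Perm X, (∀ i, k (a i) = h (a i)) → k ∈ W := by
  let _ : TopologicalSpace X := ⊥
  have : DiscreteTopology X := ⟨rfl⟩
  rw [show nhds h = Filter.comap (fun g : Equiv.Perm X => (g : X → X)) (nhds (h : X → X)) from
    nhds_induced _ _, Filter.mem_comap]
  constructor
  · rintro ⟨t, ht, htW⟩
    rw [nhds_pi, Filter.mem_pi] at ht
    obtain ⟨I, hI, s, hs, hst⟩ := ht
    obtain ⟨n, a, ha⟩ := hI.fin_embedding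
    refine ⟨n, a, fun k hk => htW (hst fun x hx => ?_)⟩
    obtain ⟨i, rfl⟩ : x ∈ Set.range a := ha ▸ hx
    change k (a i) ∈ s (a i)
    rw [hk i]
    exact mem_of_mem_nhds (hs _)
  · rintro ⟨n, a, ha⟩
    refine ⟨{f | ∀ i, f (a i) = h (a i)}, ?_, fun k hk => ha k hk⟩
    have : {f : X → X | ∀ i, f (a i) = h (a i)} = ⋂ i, {f | f (a i) = h (a i)} := by
      ext; simp
    rw [this]
    refine Filter.iInter_mem.2 fun i => ?_
    exact (continuous_apply (A := fun _ : X => X) (a i)).continuousAt.preimage_mem_nhds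
      (by rw [nhds_discrete]; exact Set.mem_singleton (h (a i)))

instance isTopologicalGroup_perm : IsTopologicalGroup (Equiv.Perm X) where
  continuous_mul := by
    rw [continuous_iff_continuousAt]
    rintro ⟨g, h⟩ W hW
    obtain ⟨n, a, ha⟩ := mem_nhds_perm_iff.1 hW
    have h1 : {k : Equiv.Perm X | ∀ i, k (a i) = h (a i)} ∈ nhds h :=
      mem_nhds_perm_iff.2 ⟨n, a, fun _ hk => hk⟩
    have h2 : {k : Equiv.Perm X | ∀ i, k (h (a i)) = g (h (a i))} ∈ nhds g :=
      mem_nhds_perm_iff.2 ⟨n, fun i => h (a i), fun _ hk => hk⟩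
    rw [Filter.mem_map]
    filter_upwards [prod_mem_nhds h2 h1] with ⟨k, l⟩ ⟨hk, hl⟩
    refine ha _ fun i => ?_
    change (k * l) (a i) = (g * h) (a i)
    rw [Equiv.Perm.mul_apply, Equiv.Perm.mul_apply, hl i, hk i]
  continuous_inv := by
    rw [continuous_iff_continuousAt]
    intro g W hW
    obtain ⟨n, a, ha⟩ := mem_nhds_perm_iff.1 hW
    have h1 : {k : Equiv.Perm X | ∀ i, k (g⁻¹ (a i)) = g (g⁻¹ (a i))} ∈ nhds g :=
      mem_nhds_perm_iff.2 ⟨n, fun i => g⁻¹ (a i), fun _ hk => hk⟩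
    rw [Filter.mem_map]
    filter_upwards [h1] with k hk
    refine ha _ fun i => ?_
    change k⁻¹ (a i) = g⁻¹ (a i)
    rw [Equiv.Perm.inv_eq_iff_eq, hk i]
    simp

/-- A closed subgroup contains each permutation that agrees on every finite tuple with one of its
elements. -/
theorem mem_of_isClosed {G : Subgroup (Equiv.Perm X)} (hG : IsClosed (G : Set (Equiv.Perm X)))
    {k : Equiv.Perm X} (hk : ∀ (n : ℕ) (a : Fin n → X), ∃ g ∈ G, ∀ i, g (a i) = k (a i)) :
    k ∈ G := by
  refine hG.closure_subset (mem_closure_iff_nhds.2 fun W hW => ?_)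
  obtain ⟨n, a, ha⟩ := mem_nhds_perm_iff.1 hW
  obtain ⟨g, hg, hga⟩ := hk n a
  exact ⟨g, ha g hga, hg⟩

end PermTopology

/-! ### The normaliser of a permutation group modulo the group -/

section Normalizer

variable {X : Type*} {G : Subgroup (Equiv.Perm X)}

/-- The orbit under `G` of an `n`-tuple. -/
def tupleOrbit (G : Subgroup (Equiv.Perm X)) {n : ℕ} (a : Fin n → X) :
    MulAction.orbitRel.Quotient G (Fin n → X) :=
  Quotient.mk'' a

theorem exists_tupleOrbit_eq {n : ℕ} (o : MulAction.orbitRel.Quotient G (Fin n → X)) :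
    ∃ a, tupleOrbit G a = o :=
  Quotient.exists_rep o

theorem tupleOrbit_eq_iff {n : ℕ} {a b : Fin n → X} :
    tupleOrbit G a = tupleOrbit G b ↔ ∃ g ∈ G, ∀ i, g (a i) = b i := by
  rw [eq_comm, tupleOrbit, tupleOrbit, Quotient.eq'', MulAction.orbitRel_apply]
  constructor
  · rintro ⟨g, hg⟩
    exact ⟨g, g.2, fun i => congrFun hg i⟩
  · rintro ⟨g, hg, h⟩
    exact ⟨⟨g, hg⟩, funext h⟩

theorem tupleOrbit_apply_eq_iff {h : Equiv.Perm X}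
    (hh : h ∈ Subgroup.normalizer (G : Set (Equiv.Perm X))) {n : ℕ} {a b : Fin n → X} :
    tupleOrbit G (fun i => h (a i)) = tupleOrbit G (fun i => h (b i)) ↔
      tupleOrbit G a = tupleOrbit G b := by
  rw [tupleOrbit_eq_iff, tupleOrbit_eq_iff]
  constructor
  · rintro ⟨g, hg, H⟩
    refine ⟨h⁻¹ * g * h, (Subgroup.mem_normalizer_iff''.1 hh g).1 hg, fun i => ?_⟩
    simp [H i]
  · rintro ⟨g, hg, H⟩
    refine ⟨h * g * h⁻¹, (Subgroup.mem_normalizer_iff.1 hh g).1 hg, fun i => ?_⟩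
    simp [H i]

/-- The action of an element of the normaliser of `G` on the `G`-orbits of tuples of each length. -/
def orbitAction (h : Subgroup.normalizer (G : Set (Equiv.Perm X))) (n : ℕ) :
    MulAction.orbitRel.Quotient G (Fin n → X) → MulAction.orbitRel.Quotient G (Fin n → X) :=
  Quotient.lift (fun a => tupleOrbit G fun i => h.1 (a i))
    fun _ _ hab => (tupleOrbit_apply_eq_iff h.2).2 (Quotient.sound hab)

theorem orbitAction_tupleOrbit (h : Subgroup.normalizer (G : Set (Equiv.Perm X))) {n : ℕ}
    (a : Fin n → X) : orbitAction h n (tupleOrbit G a) = tupleOrbit G fun i => h.1 (a i) :=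
  rfl

theorem orbitAction_eq_of_inv_mul_mem {h k : Subgroup.normalizer (G : Set (Equiv.Perm X))}
    (hk : (h⁻¹ * k : Equiv.Perm X) ∈ G) : orbitAction h = orbitAction k := by
  funext n o
  obtain ⟨a, rfl⟩ := exists_tupleOrbit_eq o
  rw [orbitAction_tupleOrbit, orbitAction_tupleOrbit, tupleOrbit_eq_iff]
  refine ⟨h * (h⁻¹ * k) * h⁻¹, (Subgroup.mem_normalizer_iff.1 h.2 _).1 hk, fun i => ?_⟩
  simp

/-- The action of the normaliser of `G` on the `G`-orbits of tuples factors through the quotient by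
`G`. -/
def quotientAction (G : Subgroup (Equiv.Perm X)) :
    Subgroup.normalizer (G : Set (Equiv.Perm X)) ⧸
      G.subgroupOf (Subgroup.normalizer (G : Set (Equiv.Perm X))) →
    ∀ n : ℕ, MulAction.orbitRel.Quotient G (Fin n → X) → MulAction.orbitRel.Quotient G (Fin n → X) :=
  Quotient.lift orbitAction fun _ _ hk =>
    orbitAction_eq_of_inv_mul_mem (Subgroup.mem_subgroupOf.1 (QuotientGroup.leftRel_apply.1 hk))

/-- For closed `G`, back and forth shows that a family of maps on orbits is the action of an element
of the normaliser as soon as any two of its members come from a common such element. -/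
theorem exists_orbitAction_eq [Countable X] (hG : IsClosed (G : Set (Equiv.Perm X)))
    (σ : ∀ n : ℕ, MulAction.orbitRel.Quotient G (Fin n → X) →
      MulAction.orbitRel.Quotient G (Fin n → X))
    (hσ : ∀ m n : ℕ, ∃ h : Subgroup.normalizer (G : Set (Equiv.Perm X)),
      orbitAction h m = σ m ∧ orbitAction h n = σ n) :
    ∃ h : Subgroup.normalizer (G : Set (Equiv.Perm X)), orbitAction h = σ := by
  have hmk : ∀ {n : ℕ} (a : Fin n → X) (c : Fin (n + 1) → X),
      (Fin.snoc a (c (Fin.last n)) : Fin (n + 1) → X) = c ↔ a = fun i => c i.castSucc := by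
    intro n a c
    constructor
    · intro h
      funext i
      rw [← congrFun h, Fin.snoc_castSucc (α := fun _ => X)]
    · rintro rfl
      exact Fin.snoc_init_self c
  -- An element of the normaliser acting as `σ` on the tuples of two lengths, corrected by an
  -- element of `G` so that it takes a given tuple `a` to a given `b` with `σ [a] = [b]`.
  have key : ∀ {m : ℕ} (k : ℕ) {a b : Fin m → X}, σ m (tupleOrbit G a) = tupleOrbit G b →
      ∃ h : Equiv.Perm X, (∀ i, h (a i) = b i) ∧
        ∀ c : Fin k → X, σ k (tupleOrbit G c) = tupleOrbit G fun i => h (c i) := by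
    intro m k a b hab
    obtain ⟨h, hm, hk⟩ := hσ m k
    rw [← hm, orbitAction_tupleOrbit, tupleOrbit_eq_iff] at hab
    obtain ⟨g, hg, hgb⟩ := hab
    refine ⟨g * h, hgb, fun c => ?_⟩
    rw [← hk, orbitAction_tupleOrbit, tupleOrbit_eq_iff]
    exact ⟨g, hg, fun i => rfl⟩
  obtain ⟨h, -, hh⟩ := exists_perm_of_back_and_forth
    (fun n a b => σ n (tupleOrbit G a) = tupleOrbit G b)
    (fun {m k a b} f hab => by
      obtain ⟨h, h1, h2⟩ := key k hab
      rw [h2]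
      congr 1
      exact funext fun i => h1 (f i))
    (fun {n a b} hab i j => by
      obtain ⟨h, h1, -⟩ := key n hab
      rw [← h1, ← h1, h.injective.eq_iff])
    (fun {n a b} hab x => by
      obtain ⟨h, h1, h2⟩ := key (n + 1) hab
      refine ⟨h x, ?_⟩
      rw [h2]
      congr 1
      funext i
      refine Fin.lastCases ?_ (fun i => ?_) i
      · simp only [Fin.snoc_last (α := fun _ => X)]
      · simp only [Fin.snoc_castSucc (α := fun _ => X), h1])
    (fun {n a b} hab y => by
      obtain ⟨h, h1, h2⟩ := key (n + 1) hab
      refine ⟨h⁻¹ y, ?_⟩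
      rw [h2]
      congr 1
      funext i
      refine Fin.lastCases ?_ (fun i => ?_) i
      · simp only [Fin.snoc_last (α := fun _ => X)]; simp
      · simp only [Fin.snoc_castSucc (α := fun _ => X), h1])
    (n := 0) (a := Fin.elim0) (b := Fin.elim0) (by
      obtain ⟨a, ha⟩ := exists_tupleOrbit_eq (σ 0 (tupleOrbit G Fin.elim0))
      rw [← ha, Subsingleton.elim a Fin.elim0])
  have hinj : ∀ n, Function.Injective (σ n) := by
    intro n o o' hoo
    obtain ⟨a, rfl⟩ := exists_tupleOrbit_eq o
    obtain ⟨b, rfl⟩ := exists_tupleOrbit_eq o'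
    obtain ⟨k, hk, -⟩ := hσ n n
    rw [← hk, orbitAction_tupleOrbit, orbitAction_tupleOrbit, tupleOrbit_apply_eq_iff k.2] at hoo
    exact hoo
  have hmem : h ∈ Subgroup.normalizer (G : Set (Equiv.Perm X)) := by
    refine Subgroup.mem_normalizer_iff.2 fun g => ⟨fun hg => ?_, fun hg => ?_⟩
    · refine mem_of_isClosed hG fun n a => tupleOrbit_eq_iff.1 ?_
      have h1 := hh n fun i => h⁻¹ (a i)
      have h2 := hh n fun i => g (h⁻¹ (a i))
      have h3 : tupleOrbit G (fun i => h⁻¹ (a i)) = tupleOrbit G fun i => g (h⁻¹ (a i)) :=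
        tupleOrbit_eq_iff.2 ⟨g, hg, fun _ => rfl⟩
      rw [← h3, h1] at h2
      simpa using h2
    · refine mem_of_isClosed hG fun n a => tupleOrbit_eq_iff.1 (hinj n ?_)
      rw [hh, hh, tupleOrbit_eq_iff]
      exact ⟨_, hg, fun i => by simp⟩
  refine ⟨⟨h, hmem⟩, funext fun n => funext fun o => ?_⟩
  obtain ⟨a, rfl⟩ := exists_tupleOrbit_eq o
  exact (hh n a).symm

theorem injective_quotientAction (hG : IsClosed (G : Set (Equiv.Perm X))) :
    Function.Injective (quotientAction G) := by
  intro x y hxy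
  obtain ⟨h, rfl⟩ := QuotientGroup.mk_surjective x
  obtain ⟨k, rfl⟩ := QuotientGroup.mk_surjective y
  refine QuotientGroup.eq.2 (Subgroup.mem_subgroupOf.2 (mem_of_isClosed hG fun n a => ?_))
  have h1 : orbitAction h n (tupleOrbit G a) = orbitAction k n (tupleOrbit G a) :=
    congrFun (congrFun hxy n) (tupleOrbit G a)
  rw [orbitAction_tupleOrbit, orbitAction_tupleOrbit] at h1
  refine tupleOrbit_eq_iff.1 ((tupleOrbit_apply_eq_iff h.2).1 (h1.trans ?_))
  simp

/-- The quotient of the normaliser of a closed oligomorphic group by the group is profinite: its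
action on the orbits of tuples embeds it as a closed subspace of a product of finite discrete
spaces. -/
theorem isProfiniteGroup_normalizer_quotient [Countable X] (hG : IsClosed (G : Set (Equiv.Perm X)))
    (hO : IsOligomorphic G) :
    IsProfiniteGroup (Subgroup.normalizer (G : Set (Equiv.Perm X)) ⧸
      G.subgroupOf (Subgroup.normalizer (G : Set (Equiv.Perm X)))) := by
  let _ : ∀ n : ℕ, TopologicalSpace (MulAction.orbitRel.Quotient G (Fin n → X) →
    MulAction.orbitRel.Quotient G (Fin n → X)) := fun _ => ⊥
  have : ∀ n : ℕ, DiscreteTopology (MulAction.orbitRel.Quotient G (Fin n → X) →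
    MulAction.orbitRel.Quotient G (Fin n → X)) := fun _ => ⟨rfl⟩
  have : ∀ n : ℕ, Finite (MulAction.orbitRel.Quotient G (Fin n → X)) := hO
  have hopen : ∀ (n : ℕ) (f : MulAction.orbitRel.Quotient G (Fin n → X) →
      MulAction.orbitRel.Quotient G (Fin n → X)),
      IsOpen ((fun τ : ∀ n : ℕ, MulAction.orbitRel.Quotient G (Fin n → X) →
        MulAction.orbitRel.Quotient G (Fin n → X) => τ n) ⁻¹' {f}) := fun n f =>
    (isOpen_discrete {f}).preimage (continuous_apply n)
  have hcont : Continuous (quotientAction G) := by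
    refine continuous_quot_lift _ (continuous_pi fun n => ?_)
    refine continuous_discrete_rng.2 fun σ => isOpen_iff_mem_nhds.2 fun h hh => ?_
    have h1 : ∀ o, ∀ᶠ k in nhds h, orbitAction k n o = orbitAction h n o := fun o => by
      obtain ⟨a, rfl⟩ := exists_tupleOrbit_eq o
      have h2 : {k : Equiv.Perm X | ∀ i, k (a i) = h.1 (a i)} ∈ nhds h.1 :=
        mem_nhds_perm_iff.2 ⟨n, a, fun _ hk => hk⟩
      filter_upwards [continuous_subtype_val.continuousAt.preimage_mem_nhds h2] with k hk
      rw [orbitAction_tupleOrbit, orbitAction_tupleOrbit]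
      congr 1
      exact funext hk
    filter_upwards [Filter.eventually_all.2 h1] with k hk
    exact (funext hk).trans hh
  -- An element acting as `h` on the orbit of a tuple `a` agrees with `h` on `a` up to an element of
  -- `G`, so that the quotient carries the topology induced from the product.
  have hind : Topology.IsInducing (quotientAction G) := by
    refine Topology.isInducing_iff_nhds.2 fun x => le_antisymm
      (Filter.Tendsto.le_comap (hcont.tendsto x)) fun W hW => ?_
    obtain ⟨h, rfl⟩ := QuotientGroup.mk_surjective x
    have hW' := QuotientGroup.continuous_mk.continuousAt.preimage_mem_nhds hW
    rw [nhds_subtype_eq_comap, Filter.mem_comap] at hW'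
    obtain ⟨W', hW', hWW'⟩ := hW'
    obtain ⟨n, a, ha⟩ := mem_nhds_perm_iff.1 hW'
    refine ⟨_, (hopen n (orbitAction h n)).mem_nhds rfl, fun y hy => ?_⟩
    obtain ⟨k, rfl⟩ := QuotientGroup.mk_surjective y
    have h1 : orbitAction k n (tupleOrbit G a) = orbitAction h n (tupleOrbit G a) :=
      congrFun hy (tupleOrbit G a)
    rw [orbitAction_tupleOrbit, orbitAction_tupleOrbit, tupleOrbit_eq_iff] at h1
    obtain ⟨g, hg, hga⟩ := h1
    have hgN : g ∈ Subgroup.normalizer (G : Set (Equiv.Perm X)) := Subgroup.le_normalizer hg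
    have h2 : (QuotientGroup.mk (⟨g, hgN⟩ * k) : Subgroup.normalizer (G : Set (Equiv.Perm X)) ⧸
        G.subgroupOf (Subgroup.normalizer (G : Set (Equiv.Perm X)))) ∈ W :=
      hWW' (show g * k.1 ∈ W' from ha _ hga)
    have h3 : (QuotientGroup.mk (⟨g, hgN⟩ * k) : Subgroup.normalizer (G : Set (Equiv.Perm X)) ⧸
        G.subgroupOf (Subgroup.normalizer (G : Set (Equiv.Perm X)))) = QuotientGroup.mk k := by
      rw [QuotientGroup.mk_mul, (QuotientGroup.eq_one_iff _).2 (Subgroup.mem_subgroupOf.2 hg),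
        one_mul]
    rwa [h3] at h2
  have hclosed : IsClosed (Set.range (quotientAction G)) := by
    refine isClosed_of_closure_subset fun σ hσ => ?_
    obtain ⟨h, rfl⟩ := exists_orbitAction_eq hG σ fun m n => by
      obtain ⟨_, hτ, ⟨x, rfl⟩⟩ :=
        mem_closure_iff.1 hσ _ ((hopen m (σ m)).inter (hopen n (σ n))) ⟨rfl, rfl⟩
      obtain ⟨h, rfl⟩ := QuotientGroup.mk_surjective x
      exact ⟨h, hτ⟩
    exact ⟨QuotientGroup.mk h, rfl⟩
  refine ⟨inferInstance, ⟨hind.isCompact_iff.2 ?_⟩,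
    T2Space.of_injective_continuous (injective_quotientAction hG) hcont, ⟨?_⟩⟩
  · rw [Set.image_univ]
    exact hclosed.isCompact
  · exact isTotallyDisconnected_of_image hcont.continuousOn (injective_quotientAction hG)
      (isTotallyDisconnected_of_totallyDisconnectedSpace _)

/-- If already the elements of the normaliser that fix all orbits of `m`-tuples lie in `G`, then
the quotient is finite. -/
theorem finite_normalizer_quotient (hO : IsOligomorphic G) (m : ℕ)
    (hm : ∀ h ∈ Subgroup.normalizer (G : Set (Equiv.Perm X)),
      (∀ a : Fin m → X, ∃ g ∈ G, ∀ i, g (a i) = h (a i)) → h ∈ G) :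
    Finite (Subgroup.normalizer (G : Set (Equiv.Perm X)) ⧸
      G.subgroupOf (Subgroup.normalizer (G : Set (Equiv.Perm X)))) := by
  have := hO m
  refine Finite.of_injective (fun x => quotientAction G x m) fun x y hxy => ?_
  obtain ⟨h, rfl⟩ := QuotientGroup.mk_surjective x
  obtain ⟨k, rfl⟩ := QuotientGroup.mk_surjective y
  refine QuotientGroup.eq.2 (Subgroup.mem_subgroupOf.2 (hm _ (h⁻¹ * k).2 fun a => ?_))
  have h1 : orbitAction h m (tupleOrbit G a) = orbitAction k m (tupleOrbit G a) :=
    congrFun hxy (tupleOrbit G a)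
  rw [orbitAction_tupleOrbit, orbitAction_tupleOrbit] at h1
  refine tupleOrbit_eq_iff.1 ((tupleOrbit_apply_eq_iff h.2).1 (h1.trans ?_))
  simp

end Normalizer

/-! ### Spaces of tuples topologised by the definable sets -/

section Definable

variable (L : FirstOrder.Language.{u, v}) (M : Type w) [L.Structure M]

/-- The topology on tuples of elements of `M` generated by the sets definable without parameters.
Two tuples are topologically indistinguishable iff they have the same type; the quotient identifying
such tuples is the space of types realised in `M`. -/
@[reducible] def definableTopology (α : Type*) : TopologicalSpace (α → M) :=
  TopologicalSpace.generateFrom {S | (∅ : Set M).Definable L S}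

theorem isTopologicalBasis_definable (α : Type*) :
    @TopologicalSpace.IsTopologicalBasis _ (definableTopology L M α)
      {S : Set (α → M) | (∅ : Set M).Definable L S} :=
  let _ := definableTopology L M α
  TopologicalSpace.isTopologicalBasis_of_subbasis_of_finiteInter rfl
    ⟨Set.definable_univ, fun _ hs _ ht => hs.inter ht⟩

variable {L M}

/-- Two tuples have the same type if they lie in the same sets definable without parameters. -/
def SameType (L : FirstOrder.Language.{u, v}) {M : Type w} [L.Structure M] {α : Type*}
    (a b : α → M) : Prop :=
  ∀ S : Set (α → M), (∅ : Set M).Definable L S → (a ∈ S ↔ b ∈ S)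

theorem SameType.symm {α : Type*} {a b : α → M} (h : SameType L a b) : SameType L b a :=
  fun S hS => (h S hS).symm

theorem SameType.comp {α β : Type*} {a b : α → M} (h : SameType L a b) (f : β → α) :
    SameType L (a ∘ f) (b ∘ f) :=
  fun _ hS => h _ (hS.preimage_comp f)

theorem isOpen_of_definable {α : Type*} {S : Set (α → M)} (hS : (∅ : Set M).Definable L S) :
    @IsOpen _ (definableTopology L M α) S :=
  TopologicalSpace.isOpen_generateFrom_of_mem hS

theorem regularSpace_definableTopology (α : Type*) :
    @RegularSpace (α → M) (definableTopology L M α) := by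
  let _ := definableTopology L M α
  refine RegularSpace.of_exists_mem_nhds_isClosed_subset fun a U hU => ?_
  obtain ⟨S, hS, haS, hSU⟩ := (isTopologicalBasis_definable L M α).mem_nhds_iff.1 hU
  exact ⟨S, (isOpen_of_definable hS).mem_nhds haS,
    ⟨isOpen_of_definable (Set.Definable.compl hS)⟩, hSU⟩

theorem definable_realize {α : Type*} (φ : L.Formula α) :
    (∅ : Set M).Definable L {a : α → M | φ.Realize a} :=
  Set.empty_definable_iff.2 ⟨φ, rfl⟩

theorem SameType.realize_iff {α : Type*} {a b : α → M} (h : SameType L a b) (φ : L.Formula α) :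
    φ.Realize a ↔ φ.Realize b :=
  h _ (definable_realize φ)

theorem definable_realize_boundedFormula {n : ℕ} (φ : L.BoundedFormula Empty n) :
    (∅ : Set M).Definable L {a : Fin n → M | φ.Realize default a} := by
  have h := definable_realize (M := M)
    (φ.toFormula.relabel (Sum.elim Empty.elim id : Empty ⊕ Fin n → Fin n))
  convert h using 1
  ext a
  simp only [Set.mem_ofPred_eq, Formula.realize_relabel, BoundedFormula.realize_toFormula]
  rw [iff_iff_eq]
  congr 1
  exact Subsingleton.elim _ _

/-- A definable set of sequences depends on finitely many coordinates only. -/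
theorem exists_finite_support {D : Set (ℕ → M)} (hD : (∅ : Set M).Definable L D) :
    ∃ N : ℕ, ∀ N' ≥ N, ∃ E : Set (Fin N' → M), (∅ : Set M).Definable L E ∧
      D = {s : ℕ → M | (fun i : Fin N' => s i) ∈ E} := by
  obtain ⟨φ, rfl⟩ := Set.empty_definable_iff.1 hD
  refine ⟨φ.freeVarFinset.sup id + 1, fun N' hN' => ?_⟩
  have hlt : ∀ i : φ.freeVarFinset, (i : ℕ) < N' := fun i =>
    (Nat.lt_succ_of_le (Finset.le_sup (f := id) i.2)).trans_le hN'
  refine ⟨_, definable_realize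
    (φ.restrictFreeVar fun i => (⟨i, hlt i⟩ : Fin N') : L.Formula (Fin N')), ?_⟩
  ext s
  exact (BoundedFormula.realize_restrictFreeVar (φ := φ)
    (f := fun i => (⟨i, hlt i⟩ : Fin N')) (v := fun i : Fin N' => s i) s fun i => rfl).symm

variable (L) in
theorem countable_definable [Countable L.Symbols] (α : Type) [Countable α] :
    {S : Set (α → M) | (∅ : Set M).Definable L S}.Countable := by
  have h1 : L.card ≤ Cardinal.aleph0 := Cardinal.mk_le_aleph0_iff.2 inferInstance
  have h2 : Countable (Σ n, L.BoundedFormula α n) := by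
    refine Cardinal.mk_le_aleph0_iff.1 (BoundedFormula.card_le.trans (max_le le_rfl ?_))
    refine Cardinal.add_le_aleph0.2 ⟨?_, ?_⟩
    · exact Cardinal.lift_le_aleph0.2 (Cardinal.mk_le_aleph0_iff.2 inferInstance)
    · exact Cardinal.lift_le_aleph0.2 h1
  have h3 : Countable (L.Formula α) :=
    Function.Injective.countable (f := fun φ : L.Formula α =>
      (⟨0, φ⟩ : Σ n, L.BoundedFormula α n)) fun _ _ h => by
        simpa using h
  refine (Set.countable_range fun φ : L.Formula α => {a : α → M | φ.Realize a}).mono ?_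
  intro S hS
  obtain ⟨φ, rfl⟩ := Set.empty_definable_iff.1 hS
  exact ⟨φ, rfl⟩

end Definable

/-! ### Categoricity: saturation and omission of types -/

section Categorical

variable {L : FirstOrder.Language.{u, v}} {M : Type w} [L.Structure M]

theorem IsAlephZeroCategorical.exists_equiv (h : IsAlephZeroCategorical L M) (N : Type w)
    [L.Structure N] [Countable N] [Infinite N] [N ⊨ L.completeTheory M] :
    Nonempty (M ≃[L] N) := by
  have := h.countable
  have := h.infinite
  exact h.categorical (Theory.ModelType.of (L.completeTheory M) M)
    (Theory.ModelType.of (L.completeTheory M) N) (Cardinal.mk_eq_aleph0 M) (Cardinal.mk_eq_aleph0 N)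

/-- A countable `ℵ₀`-categorical structure is saturated: by compactness and Löwenheim–Skolem, a
finitely realised set of formulas in countably many variables is realised in a countable model, which
is isomorphic to the given one. -/
theorem IsAlephZeroCategorical.exists_realize [Countable L.Symbols]
    (h : IsAlephZeroCategorical L M) {α : Type} [Countable α] (S : Set (L.Formula α))
    (hS : ∀ t : Set (L.Formula α), t.Finite → t ⊆ S → ∃ a : α → M, ∀ φ ∈ t, φ.Realize a) :
    ∃ a : α → M, ∀ φ ∈ S, φ.Realize a := by
  have := h.countable
  have := h.infinite
  let T : L[[α]].Theory :=
    (L.lhomWithConstants α).onTheory (L.completeTheory M) ∪ Formula.equivSentence '' S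
  have hT : T.IsSatisfiable := by
    refine Theory.isSatisfiable_iff_isFinitelySatisfiable.2 fun T₀ hT₀ => ?_
    obtain ⟨a, ha⟩ := hS (S ∩ Formula.equivSentence ⁻¹' T₀)
      ((T₀.finite_toSet.preimage Formula.equivSentence.injective.injOn).inter_of_right S)
      Set.inter_subset_left
    let _ : (constantsOn α).Structure M := constantsOn.structure a
    have : M ⊨ (T₀ : L[[α]].Theory) := by
      refine ⟨fun φ hφ => ?_⟩
      rcases hT₀ hφ with h1 | ⟨ψ, hψ, rfl⟩
      · have : M ⊨ (L.lhomWithConstants α).onTheory (L.completeTheory M) :=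
          (LHom.onTheory_model _ _).2 inferInstance
        exact Theory.realize_sentence_of_mem _ h1
      · exact (Formula.realize_equivSentence M ψ).2 (ha ψ ⟨hψ, hφ⟩)
    exact Theory.Model.isSatisfiable M
  have hinf : ∀ N : T.ModelType, Infinite N := fun N => by
    let N' : (L.completeTheory M).ModelType :=
      (N.subtheoryModel Set.subset_union_left).reduct (L.lhomWithConstants α)
    have hN : N' ⊨ L.infiniteTheory := ⟨fun φ hφ => Theory.realize_sentence_of_mem
      (L.completeTheory M) (Theory.realize_sentence_of_mem L.infiniteTheory (M := M) hφ)⟩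
    exact (L.model_infiniteTheory_iff (M := N')).1 hN
  have hcard : Cardinal.lift.{w} L[[α]].card ≤ Cardinal.lift.{max u v} Cardinal.aleph0.{w} := by
    rw [Cardinal.lift_aleph0, Cardinal.lift_le_aleph0, card_withConstants, Cardinal.add_le_aleph0,
      Cardinal.lift_le_aleph0, Cardinal.lift_le_aleph0]
    exact ⟨Cardinal.mk_le_aleph0_iff.2 inferInstance, Cardinal.mk_le_aleph0_iff.2 inferInstance⟩
  obtain ⟨N, hN⟩ := Theory.exists_model_card_eq ⟨hT.some, hinf _⟩ Cardinal.aleph0.{w} le_rfl hcard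
  let N' : (L.completeTheory M).ModelType :=
    (N.subtheoryModel Set.subset_union_left).reduct (L.lhomWithConstants α)
  obtain ⟨e⟩ := h.categorical N' (Theory.ModelType.of _ M) hN (Cardinal.mk_eq_aleph0 M)
  refine ⟨fun i => e (L.con i : N), fun φ hφ => ?_⟩
  have h1 : (Formula.equivSentence φ).Realize N :=
    Theory.realize_sentence_of_mem T (Or.inr ⟨φ, hφ, rfl⟩)
  have h2 : Formula.Realize (M := N') φ fun i => (L.con i : N) :=
    (@Formula.realize_equivSentence L N' _ α N.struc
      ((L.lhomWithConstants α).isExpansionOn_reduct N) φ).1 h1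
  exact (StrongHomClass.realize_formula e φ).2 h2

/-- Saturation, restated for the topology generated by the definable sets. -/
theorem IsAlephZeroCategorical.compactSpace [Countable L.Symbols]
    (h : IsAlephZeroCategorical L M) (α : Type) [Countable α] :
    @CompactSpace (α → M) (definableTopology L M α) := by
  let _ := definableTopology L M α
  refine ⟨isCompact_iff_ultrafilter_le_nhds.2 fun F _ => ?_⟩
  obtain ⟨a, ha⟩ := h.exists_realize {φ : L.Formula α | {b : α → M | φ.Realize b} ∈ F}
    fun t ht htS => by
      have : (⋂ φ ∈ t, {b : α → M | φ.Realize b}) ∈ F :=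
        (Filter.biInter_mem ht).2 fun φ hφ => htS hφ
      obtain ⟨a, ha⟩ := Ultrafilter.nonempty_of_mem this
      exact ⟨a, fun φ hφ => Set.mem_iInter₂.1 ha φ hφ⟩
  refine ⟨a, trivial, ?_⟩
  rw [TopologicalSpace.nhds_generateFrom]
  refine le_iInf₂ fun S hS => Filter.le_principal_iff.2 ?_
  obtain ⟨haS, hS⟩ := hS
  by_contra hSF
  obtain ⟨φ, hφ⟩ := Set.empty_definable_iff.1 (Set.Definable.compl hS)
  have h1 := ha φ (show {b : α → M | φ.Realize b} ∈ F from
    hφ ▸ Ultrafilter.compl_mem_iff_notMem.2 hSF)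
  have h2 : a ∈ Sᶜ := hφ ▸ h1
  exact h2 haS

/-- All types of tuples in a countable `ℵ₀`-categorical structure are isolated. Otherwise a sequence
generic for the topology given by the definable sets enumerates an elementary substructure in which a
non-isolated type is omitted; but by categoricity the substructure is isomorphic to the whole. -/
theorem IsAlephZeroCategorical.exists_isolating [Countable L.Symbols]
    (h : IsAlephZeroCategorical L M) {n : ℕ} (a : Fin n → M) :
    ∃ D : Set (Fin n → M), (∅ : Set M).Definable L D ∧ a ∈ D ∧ ∀ b ∈ D, SameType L a b := by
  by_contra! hno
  have := h.countable
  have := h.infinite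
  let _ := definableTopology L M ℕ
  have := h.compactSpace ℕ
  have := regularSpace_definableTopology (L := L) (M := M) ℕ
  -- A generic sequence `s` lies in all sets `H i`, which makes its range pass the Tarski–Vaught
  -- test, and in all sets `O k`, which makes its range omit the type of `a`.
  let H : (Σ m : ℕ, {D : Set (Fin (m + 1) → M) | (∅ : Set M).Definable L D} × (Fin m → ℕ)) →
      Set (ℕ → M) := fun i => {s | (∃ c, (Fin.snoc (s ∘ i.2.2) c : Fin (i.1 + 1) → M) ∈ i.2.1.1) →
        ∃ j, (Fin.snoc (s ∘ i.2.2) (s j) : Fin (i.1 + 1) → M) ∈ i.2.1.1}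
  let O : (Fin n → ℕ) → Set (ℕ → M) := fun k => {s | ¬ SameType L a (s ∘ k)}
  have hsnoc : ∀ (m : ℕ) (s : ℕ → M) (k : Fin m → ℕ) (j : ℕ),
      (Fin.snoc (s ∘ k) (s j) : Fin (m + 1) → M) = s ∘ (Fin.snoc k j : Fin (m + 1) → ℕ) := by
    intro m s k j
    exact (Fin.comp_snoc s k j).symm
  have hHo : ∀ i, IsOpen (H i) := by
    rintro ⟨m, ⟨D, hD⟩, k⟩
    have h1 : (∅ : Set M).Definable L
        {b : Fin m → M | ∃ c, (Fin.snoc b c : Fin (m + 1) → M) ∈ D} := by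
      convert Set.Definable.image_comp hD Fin.castSucc using 1
      ext b
      constructor
      · rintro ⟨c, hc⟩
        exact ⟨_, hc, Fin.init_snoc (α := fun _ => M) _ _⟩
      · rintro ⟨d, hd, rfl⟩
        refine ⟨d (Fin.last m), ?_⟩
        rwa [show (Fin.snoc (d ∘ Fin.castSucc) (d (Fin.last m)) : Fin (m + 1) → M) = d from
          Fin.snoc_init_self d]
    have h2 : H ⟨m, ⟨D, hD⟩, k⟩ =
        {s | s ∘ k ∈ {b : Fin m → M | ∃ c, (Fin.snoc b c : Fin (m + 1) → M) ∈ D}}ᶜ ∪ ⋃ j,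
          {s | s ∘ (Fin.snoc k j : Fin (m + 1) → ℕ) ∈ D} := by
      ext s
      simp only [H, Set.mem_union, Set.mem_compl_iff, Set.mem_iUnion, Set.mem_ofPred_eq, hsnoc,
        imp_iff_not_or]
    rw [h2]
    exact (isOpen_of_definable (Set.Definable.compl (h1.preimage_comp k))).union
      (isOpen_iUnion fun j => isOpen_of_definable (hD.preimage_comp _))
  have hHd : ∀ i, Dense (H i) := by
    rintro ⟨m, ⟨D, hD⟩, k⟩
    refine (isTopologicalBasis_definable L M ℕ).dense_iff.2 fun U hU ⟨s, hs⟩ => ?_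
    obtain ⟨N, hN⟩ := exists_finite_support hU
    obtain ⟨E, -, rfl⟩ := hN N le_rfl
    by_cases hc : ∃ c, (Fin.snoc (s ∘ k) c : Fin (m + 1) → M) ∈ D
    · obtain ⟨c, hc⟩ := hc
      -- Store the witness at an index beyond those that `U` and `k` refer to.
      let j := N + Finset.univ.sup k + 1
      have hj : ∀ i, k i ≠ j := fun i => by
        have := Finset.le_sup (f := k) (Finset.mem_univ i)
        omega
      have h1 : Function.update s j c ∘ k = s ∘ k :=
        funext fun i => Function.update_of_ne (hj i) _ _
      refine ⟨Function.update s j c, ?_, fun _ => ⟨j, ?_⟩⟩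
      · have h2 : (fun i : Fin N => Function.update s j c i) = fun i : Fin N => s i :=
          funext fun i => Function.update_of_ne (by have := i.2; omega) _ _
        change (fun i : Fin N => Function.update s j c i) ∈ E
        rw [h2]
        exact hs
      · change (Fin.snoc (Function.update s j c ∘ k) (Function.update s j c j) :
          Fin (m + 1) → M) ∈ D
        rw [h1, Function.update_self]
        exact hc
    · exact ⟨s, hs, fun h => absurd h hc⟩
  have hOo : ∀ k, IsOpen (O k) := by
    intro k
    refine isOpen_iff_forall_mem_open.2 fun s hs => ?_
    obtain ⟨S, hS, hSs⟩ : ∃ S : Set (Fin n → M), (∅ : Set M).Definable L S ∧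
        ¬ (a ∈ S ↔ s ∘ k ∈ S) := by
      simpa [O, SameType] using hs
    by_cases haS : a ∈ S
    · refine ⟨{t | t ∘ k ∈ Sᶜ}, fun t ht hat => ht ((hat S hS).1 haS),
        isOpen_of_definable (hS.compl.preimage_comp k), ?_⟩
      exact fun h => hSs ⟨fun _ => h, fun _ => haS⟩
    · refine ⟨{t | t ∘ k ∈ S}, fun t ht hat => haS ((hat S hS).2 ht),
        isOpen_of_definable (hS.preimage_comp k), ?_⟩
      by_contra h
      exact hSs ⟨fun h' => absurd h' haS, fun h' => absurd h' h⟩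
  have hOd : ∀ k, Dense (O k) := by
    intro k
    refine (isTopologicalBasis_definable L M ℕ).dense_iff.2 fun U hU ⟨s, hs⟩ => ?_
    by_contra hempty
    have hall : ∀ t ∈ U, SameType L a (t ∘ k) := fun t ht => by
      by_contra hta
      exact hempty ⟨t, ht, hta⟩
    -- Otherwise the projection of `U` along `k` would isolate the type of `a`.
    obtain ⟨N, hN⟩ := exists_finite_support hU
    obtain ⟨E, hE, rfl⟩ := hN (N + Finset.univ.sup k + 1) (by omega)
    have hk : ∀ i, k i < N + Finset.univ.sup k + 1 := fun i => by
      have := Finset.le_sup (f := k) (Finset.mem_univ i)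
      omega
    have hD := Set.Definable.image_comp hE fun i : Fin n => (⟨k i, hk i⟩ : Fin _)
    have hD' : ∀ b ∈ (fun g : Fin (N + Finset.univ.sup k + 1) → M =>
        g ∘ fun i : Fin n => (⟨k i, hk i⟩ : Fin _)) '' E, SameType L a b := by
      rintro _ ⟨g, hg, rfl⟩
      let t : ℕ → M := fun i => if hi : i < N + Finset.univ.sup k + 1 then g ⟨i, hi⟩ else s 0
      have h1 : (fun i : Fin (N + Finset.univ.sup k + 1) => t i) = g :=
        funext fun i => dif_pos i.2
      have h2 : t ∘ k = g ∘ fun i : Fin n => (⟨k i, hk i⟩ : Fin _) :=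
        funext fun i => dif_pos (hk i)
      change SameType L a (g ∘ fun i : Fin n => (⟨k i, hk i⟩ : Fin _))
      rw [← h2]
      refine hall t ?_
      change (fun i : Fin (N + Finset.univ.sup k + 1) => t i) ∈ E
      rwa [h1]
    have haD : a ∈ (fun g : Fin (N + Finset.univ.sup k + 1) → M =>
        g ∘ fun i : Fin n => (⟨k i, hk i⟩ : Fin _)) '' E :=
      (hD' _ ⟨_, hs, rfl⟩ _ hD).2 ⟨_, hs, rfl⟩
    obtain ⟨b, hb, hab⟩ := hno _ hD haD
    exact hab (hD' b hb)
  have hcount : ∀ m : ℕ, Countable {D : Set (Fin (m + 1) → M) | (∅ : Set M).Definable L D} :=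
    fun m => (countable_definable L (Fin (m + 1))).to_subtype
  obtain ⟨s, hs⟩ := (dense_iInter_of_isOpen (f := Sum.elim H O) (Sum.rec hHo hOo)
    (Sum.rec hHd hOd)).nonempty
  rw [Set.mem_iInter] at hs
  have hH : ∀ (m : ℕ) (D : Set (Fin (m + 1) → M)), (∅ : Set M).Definable L D →
      ∀ x : Fin m → M, (∀ i, x i ∈ Set.range s) → ∀ c, (Fin.snoc x c : Fin (m + 1) → M) ∈ D →
        ∃ j, (Fin.snoc x (s j) : Fin (m + 1) → M) ∈ D := by
    intro m D hD x hx c hc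
    choose k hk using hx
    obtain rfl : s ∘ k = x := funext hk
    exact hs (Sum.inl ⟨m, ⟨D, hD⟩, k⟩) ⟨c, hc⟩
  let S : L.Substructure M :=
    { carrier := Set.range s
      fun_mem := fun {m} f x hx => by
        let φ : L.Formula (Fin (m + 1)) :=
          (Term.func f fun i : Fin m => Term.var i.castSucc).equal (Term.var (Fin.last m))
        have hφ : ∀ c, φ.Realize (Fin.snoc x c : Fin (m + 1) → M) ↔ Structure.funMap f x = c := by
          intro c
          simp [φ, Formula.realize_equal, Fin.snoc_castSucc (α := fun _ => M),
            Fin.snoc_last (α := fun _ => M)]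
        obtain ⟨j, hj⟩ := hH m _ (definable_realize φ) x hx _ ((hφ _).2 rfl)
        exact ⟨j, ((hφ _).1 hj).symm⟩ }
  let N : L.ElementarySubstructure M := S.toElementarySubstructure fun m φ x c hc => by
    obtain ⟨j, hj⟩ :=
      hH m _ (definable_realize_boundedFormula φ) (fun i => x i) (fun i => (x i).2) c hc
    exact ⟨⟨s j, j, rfl⟩, hj⟩
  have : Infinite N := N.elementarilyEquivalent.infinite_iff.2 h.infinite
  obtain ⟨e⟩ := h.exists_equiv N
  have hmem : ∀ i, ∃ j, s j = (e (a i) : M) := fun i => (e (a i)).2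
  choose k hk using hmem
  refine hs (Sum.inr k) fun D hD => ?_
  obtain ⟨φ, rfl⟩ := Set.empty_definable_iff.1 hD
  have h1 := N.subtype.map_formula φ (fun i => e (a i))
  have h2 := StrongHomClass.realize_formula e φ (v := a)
  have h3 : s ∘ k = fun i => (e (a i) : M) := funext hk
  rw [h3]
  exact (h1.trans h2).symm

end Categorical

/-! ### Automorphisms of countable categorical structures -/

section Automorphisms

variable {L : FirstOrder.Language.{u, v}} {M : Type w} [L.Structure M]

theorem sameType_of_mem_aut {g : Equiv.Perm M} (hg : g ∈ aut L M) {α : Type*} (a : α → M) :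
    SameType L a (g ∘ a) := by
  obtain ⟨e, rfl⟩ := hg
  intro S hS
  obtain ⟨φ, rfl⟩ := Set.empty_definable_iff.1 hS
  exact (StrongHomClass.realize_formula e φ (v := a)).symm

theorem mem_aut_of_isReduct {L' : FirstOrder.Language.{u', v'}} [L'.Structure M]
    (hL : IsReduct L L' M) {g : Equiv.Perm M}
    (hg : ∀ (n : ℕ) (a : Fin n → M), SameType L a (g ∘ a)) : g ∈ aut L' M := by
  refine ⟨{ toEquiv := g, map_fun' := fun {n} f x => ?_, map_rel' := fun {n} r x => ?_ }, rfl⟩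
  · let e : Option (Fin n) ≃ Fin (n + 1) := (finSuccEquiv n).symm
    let c : Option (Fin n) → M := fun o => o.elim (Structure.funMap f x) x
    have h1 : SameType L c (g ∘ c) := by
      have := (hg (n + 1) (c ∘ e.symm)).comp e
      simpa [Function.comp_assoc] using this
    exact ((h1 _ (hL.1 n f)).1 rfl).symm
  · exact (hg n x _ (hL.2 n r)).symm

theorem isReduct_refl : IsReduct L L M :=
  ⟨fun _ f => Set.DefinableFun.fun_symbol f, fun n r =>
    definable_realize (r.formula fun i : Fin n => Term.var i)⟩

theorem aut_le_aut_of_isReduct {L' : FirstOrder.Language.{u', v'}} [L'.Structure M]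
    (hL : IsReduct L L' M) : aut L M ≤ aut L' M :=
  fun _ hg => mem_aut_of_isReduct hL fun _ a => sameType_of_mem_aut hg a

theorem isClosed_aut : IsClosed (aut L M : Set (Equiv.Perm M)) := by
  refine isClosed_of_closure_subset fun k hk => mem_aut_of_locally fun n _ a => ?_
  obtain ⟨g, hga, hg⟩ := mem_closure_iff_nhds.1 hk _ (mem_nhds_perm_iff.2 ⟨n, a, fun _ h => h⟩)
  exact ⟨g, hg, hga⟩

theorem autOrbital_eq_normalizer :
    autOrbital L M = Subgroup.normalizer (aut L M : Set (Equiv.Perm M)) := by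
  refine le_antisymm (fun h hh => ?_) fun h hh => mem_autOrbital_of fun n _ a b => ?_
  · have key : ∀ k ∈ autOrbital L M, ∀ g ∈ aut L M, k * g * k⁻¹ ∈ aut L M := fun k hk g hg =>
      Subgroup.mem_subgroupOf.1 (normal_aut.conj_mem ⟨g, aut_le_autOrbital hg⟩
        (Subgroup.mem_subgroupOf.2 hg) ⟨k, hk⟩)
    refine Subgroup.mem_normalizer_iff.2 fun g => ⟨key h hh g, fun hg => ?_⟩
    have := key h⁻¹ (inv_mem hh) _ hg
    simpa [mul_assoc] using this
  · rw [← tupleOrbit_eq_iff, ← tupleOrbit_eq_iff]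
    exact tupleOrbit_apply_eq_iff hh

/-- In a countable `ℵ₀`-categorical structure all types of tuples are isolated, so that back and
forth moves any tuple to any other tuple of the same type. -/
theorem IsAlephZeroCategorical.exists_mem_aut [Countable L.Symbols]
    (h : IsAlephZeroCategorical L M) {n : ℕ} {a b : Fin n → M} (hab : SameType L a b) :
    ∃ g ∈ aut L M, ∀ i, g (a i) = b i := by
  have := h.countable
  have forth : ∀ {n : ℕ} {a b : Fin n → M}, SameType L a b → ∀ x, ∃ y,
      SameType L (Fin.snoc a x : Fin (n + 1) → M) (Fin.snoc b y : Fin (n + 1) → M) := by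
    intro n a b hab x
    obtain ⟨D, hD, haD, hDa⟩ := h.exists_isolating (Fin.snoc a x : Fin (n + 1) → M)
    have ha : a ∈ (fun d : Fin (n + 1) → M => d ∘ Fin.castSucc) '' D :=
      ⟨_, haD, Fin.init_snoc (α := fun _ => M) _ _⟩
    obtain ⟨d, hd, rfl⟩ := (hab _ (hD.image_comp Fin.castSucc)).1 ha
    refine ⟨d (Fin.last n), ?_⟩
    rw [show (Fin.snoc (d ∘ Fin.castSucc) (d (Fin.last n)) : Fin (n + 1) → M) = d from
      Fin.snoc_init_self d]
    exact hDa d hd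
  obtain ⟨g, hga, hg⟩ := exists_perm_of_back_and_forth (fun _ a b => SameType L a b)
    (fun f hab => hab.comp f)
    (fun {n a b} hab i j => by
      simpa [Formula.realize_equal] using
        hab.realize_iff ((Term.var i : L.Term (Fin n)).equal (Term.var j)))
    forth
    (fun hab y => by
      obtain ⟨x, hx⟩ := forth hab.symm y
      exact ⟨x, hx.symm⟩)
    hab
  exact ⟨g, mem_aut_of_isReduct isReduct_refl hg, hga⟩

/-- The theorem of Ryll-Nardzewski: the automorphism group of a countable `ℵ₀`-categorical structure
is oligomorphic. -/
theorem IsAlephZeroCategorical.isOligomorphic [Countable L.Symbols]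
    (h : IsAlephZeroCategorical L M) : IsOligomorphic (aut L M) := by
  intro n
  let _ := definableTopology L M (Fin n)
  have := h.compactSpace (Fin n)
  choose D hD haD hDa using fun a : Fin n → M => h.exists_isolating a
  obtain ⟨t, ht⟩ := CompactSpace.elim_nhds_subcover D fun a =>
    (isOpen_of_definable (hD a)).mem_nhds (haD a)
  refine Finite.of_surjective (fun a : t => tupleOrbit (aut L M) a.1) fun o => ?_
  obtain ⟨b, rfl⟩ := exists_tupleOrbit_eq o
  obtain ⟨a, hat, hb⟩ : ∃ a ∈ t, b ∈ D a := by
    have : b ∈ ⋃ a ∈ t, D a := ht ▸ Set.mem_univ b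
    simpa using this
  exact ⟨⟨a, hat⟩, tupleOrbit_eq_iff.2 (h.exists_mem_aut (hDa a b hb))⟩

/-- In a finite signature automorphisms are recognised by their action on tuples of bounded
length. -/
theorem exists_forall_mem_aut (L : FirstOrder.Language.{u, v}) (M : Type w) [L.Structure M]
    [Finite L.Symbols] [Nonempty M] :
    ∃ m : ℕ, ∀ k : Equiv.Perm M,
      (∀ a : Fin m → M, ∃ g ∈ aut L M, ∀ i, g (a i) = k (a i)) → k ∈ aut L M := by
  obtain ⟨m, hm⟩ := (Set.finite_range (Sum.elim (fun f => f.1 + 1) (fun r => r.1) :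
    L.Symbols → ℕ)).bddAbove
  refine ⟨m, fun k hk => ?_⟩
  have key : ∀ n ≤ m, ∀ a : Fin n → M, ∃ g ∈ aut L M, ∀ i, g (a i) = k (a i) := by
    intro n hn a
    obtain ⟨g, hg, hga⟩ := hk fun i =>
      if hi : (i : ℕ) < n then a ⟨i, hi⟩ else Classical.arbitrary M
    refine ⟨g, hg, fun i => ?_⟩
    simpa using hga (Fin.castLE hn i)
  refine ⟨{ toEquiv := k, map_fun' := fun {n} f x => ?_, map_rel' := fun {n} r x => ?_ }, rfl⟩
  · obtain ⟨_, ⟨e, rfl⟩, he⟩ := key (n + 1) (hm ⟨Sum.inl ⟨n, f⟩, rfl⟩)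
      (Fin.snoc x (Structure.funMap f x))
    have h1 : e (Structure.funMap f x) = k (Structure.funMap f x) := by
      have h0 := he (Fin.last n)
      rw [Fin.snoc_last (α := fun _ => M)] at h0
      exact h0
    have h2 : e ∘ x = k ∘ x := funext fun i => by
      have h0 := he i.castSucc
      rw [Fin.snoc_castSucc (α := fun _ => M)] at h0
      exact h0
    exact h1.symm.trans ((e.map_fun f x).trans (congrArg _ h2))
  · obtain ⟨_, ⟨e, rfl⟩, he⟩ := key n (hm ⟨Sum.inr ⟨n, r⟩, rfl⟩) x
    have h2 : e ∘ x = k ∘ x := funext he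
    exact (iff_of_eq (congrArg _ h2)).symm.trans (e.map_rel r x)

end Automorphisms

/-! ### The quotient for a categorical structure -/

section OrbitalQuotient

variable {L : FirstOrder.Language.{u, v}} {M : Type w} [L.Structure M] [Countable L.Symbols]

theorem IsAlephZeroCategorical.isProfiniteGroup_orbitalQuotient (h : IsAlephZeroCategorical L M) :
    IsProfiniteGroup (OrbitalQuotient L M) := by
  have := h.countable
  -- Stated for a variable `N`, so that `Aut(E_M)` can be replaced by the normaliser.
  have key : ∀ (N : Subgroup (Equiv.Perm M)) [((aut L M).subgroupOf N).Normal],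
      N = Subgroup.normalizer (aut L M : Set (Equiv.Perm M)) →
        IsProfiniteGroup (N ⧸ (aut L M).subgroupOf N) := by
    rintro _ _ rfl
    exact isProfiniteGroup_normalizer_quotient isClosed_aut h.isOligomorphic
  exact key _ autOrbital_eq_normalizer

theorem IsAlephZeroCategorical.finite_orbitalQuotient (h : IsAlephZeroCategorical L M)
    (L' : FirstOrder.Language.{u', v'}) [Finite L'.Symbols] [L'.Structure M]
    (hL : Interdefinable L L' M) : Finite (OrbitalQuotient L M) := by
  have := h.infinite
  have haut : aut L M = aut L' M :=
    le_antisymm (aut_le_aut_of_isReduct hL.1) (aut_le_aut_of_isReduct hL.2)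
  obtain ⟨m, hm⟩ := exists_forall_mem_aut L' M
  rw [← haut] at hm
  rw [OrbitalQuotient, autOrbital_eq_normalizer]
  exact finite_normalizer_quotient h.isOligomorphic m fun k _ => hm k

end OrbitalQuotient

end OrbitalProfinite

theorem theorem3p4 :
    (∀ (L : FirstOrder.Language.{u, v}) (M : Type w) [Countable L.Symbols] [L.Structure M],
      OrbitalProfinite.IsAlephZeroCategorical L M →
        OrbitalProfinite.autOrbital L M =
          Subgroup.normalizer (OrbitalProfinite.aut L M : Set (Equiv.Perm M)) ∧
        OrbitalProfinite.IsProfiniteGroup (OrbitalProfinite.OrbitalQuotient L M) ∧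
        ∀ (L' : FirstOrder.Language.{u', v'}) [Finite L'.Symbols] [L'.Structure M],
          OrbitalProfinite.Interdefinable L L' M →
            Finite (OrbitalProfinite.OrbitalQuotient L M)) ∧
    (∀ (X : Type w) [Countable X] [Infinite X] (G : Subgroup (Equiv.Perm X)),
      IsClosed (G : Set (Equiv.Perm X)) → OrbitalProfinite.IsOligomorphic G →
        OrbitalProfinite.IsProfiniteGroup
          (Subgroup.normalizer (G : Set (Equiv.Perm X)) ⧸
            G.subgroupOf (Subgroup.normalizer (G : Set (Equiv.Perm X))))) := by
  refine ⟨fun L M _ _ h => ⟨OrbitalProfinite.autOrbital_eq_normalizer,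
    h.isProfiniteGroup_orbitalQuotient, fun L' _ _ hL => h.finite_orbitalQuotient L' hL⟩, ?_⟩
  exact fun X _ _ G hG hO => OrbitalProfinite.isProfiniteGroup_normalizer_quotient hG hO
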